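/- **Setting.** Let $n\ge 0$, $N\ge 1$, $[N]=\{1,\dots,N\}$, $\operatorname{dom}F=\{x: F(x)<\infty\}$, and consider minimizing $\varphi=\frac1N\sum_{i=1}^N f_i+g$ over $\overline C$, where $f_i,g,h_i:\mathbb R^n\to\mathbb R\cup\{+\infty\}$ and $C=\bigcap_{i=1}^N\operatorname{int}\operatorname{dom}h_i$. A *Legendre kernel* is a proper, lower semicontinuous (lsc), strictly convex function $h:\mathbb R^n\to\mathbb R\cup\{+\infty\}$ that is $C^1$ on $\operatorname{int}\operatorname{dom}h\neq\emptyset$, is $1$-coercive ($h(x)/\|x\|\to\infty$ as $\|x\|\to\infty$), and satisfies $\|\nabla h(x_k)\|\to\infty$ whenever $\operatorname{int}\operatorname{dom}h\ni x_k\to x\in\operatorname{bdry}\operatorname{dom}h$. A proper lsc function $f$ is *$L$-smooth relative to $h$* ($L\ge0$) if $\operatorname{dom}f\supseteq\operatorname{dom}h$ and $Lh\pm f$ are convex on $\operatorname{int}\operatorname{dom}h$. The *Bregman distance* of $h$ is $D_h(x,y)=h(x)-h(y)-\langle\nabla h(y),x-y\rangle$ if $y\in\operatorname{int}\operatorname{dom}h$,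 and $+\infty$ otherwise. We write $v\in\hat\partial F(\bar x)$ if $F(\bar x)$ is finite and $\liminf_{\bar x\ne x\to\bar x}\frac{F(x)-F(\bar x)-\langle v,x-\bar x\rangle}{\|x-\bar x\|}\ge0$. By convention, $\operatorname{argmin}$ of a function that is identically $+\infty$ is empty. **Basic assumption.** (1) Each $f_i$ is $L_{f_i}$-smooth relative to the Legendre kernel $h_i$; (2) $g$ is proper and lsc; (3) $\operatorname{argmin}_{\overline C}\varphi\ne\emptyset$; (4) $\gamma_i\in(0,N/L_{f_i})$ (where $N/0=\infty$), and for every $s\in\mathbb R^n$ $$T(s):=\operatorname{argmin}_{w\in\mathbb R^n}\Big\{g(w)+\sum_{i=1}^N\tfrac1{\gamma_i}h_i(w)-\langle s,w\rangle\Big\}\subseteq C.$$ **Assumption II.** For every $i$, $\operatorname{dom}h_i$ is closed and $D_{h_i}(z,z^k)\to0$ whenever $\operatorname{int}\operatorname{dom}h_i\ni z^k\to z\in\operatorname{bdry}\operatorname{dom}h_i$. **Algorithm 2 (low-memory Bregman Finito/MISO).** Put $p_i(x)=\frac1{\gamma_i}\nabla h_i(x)-\frac1N\nabla f_i(x)$.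 Start from $x^{\rm init}\in C$, $\tilde s^0=\sum_{i=1}^N p_i(x^{\rm init})$ and $\mathcal K^0=\emptyset$. For $k=0,1,2,\dots$ choose $z^k\in T(\tilde s^k)$ and * if $\mathcal K^k=\emptyset$: $\mathcal I^{k+1}=\mathcal K^{k+1}=[N]$, $\tilde z^k=z^k$, $\tilde s^{k+1}=\sum_{i=1}^N p_i(z^k)$; * otherwise: select a nonempty $\mathcal I^{k+1}\subseteq\mathcal K^k$ and set $\mathcal K^{k+1}=\mathcal K^k\setminus\mathcal I^{k+1}$, $\tilde z^k=\tilde z^{k-1}$, $\tilde s^{k+1}=\tilde s^k+\sum_{i\in\mathcal I^{k+1}}\big[p_i(z^k)-p_i(\tilde z^k)\big]$. With such a run associate $\boldsymbol x^k=(x_1^k,\dots,x_N^k)$ given by $x_i^0=x^{\rm init}$, $x_i^{k+1}=z^k$ if $i\in\mathcal I^{k+1}$, and $x_i^{k+1}=x_i^k$ otherwise. Let $\hat h_i=\frac1{\gamma_i}h_i-\frac1Nf_i$ (with $\infty-\infty=\infty$), let $\Phi(\boldsymbol w)=\frac1N\sum_i f_i(w_i)+\frac1N\sum_i g(w_i)$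 if $w_1=\dots=w_N$ and $\Phi(\boldsymbol w)=+\infty$ otherwise, and define the Bregman–Moreau envelope $$\Phi^{\hat H}(\boldsymbol x)=\inf_{\boldsymbol w\in(\mathbb R^n)^N}\Big\{\Phi(\boldsymbol w)+\sum_{i=1}^N D_{\hat h_i}(w_i,x_i)\Big\}.$$ **Theorem (subsequential convergence of Algorithm 2).** Suppose that the basic assumption holds, consider any sequence generated by Algorithm 2, and let $\omega$ be the set of limit points of $(\tilde z^k)_{k\in\mathbb N}$. Then there is a real number $\varphi_\star$ with $$\inf_{\overline C}\varphi\le\inf_C\varphi\le\varphi_\star\le\varphi(x^{\rm init})$$ such that $(\Phi^{\hat H}(\boldsymbol x^k))_{k\in\mathbb N}$ decreases monotonically to $\varphi_\star$, and 1. $\varphi(\tilde z^k)\to\varphi_\star$ as $k\to\infty$; 2. if Assumption II holds and, for every $i$, the functions $L_{f_i}h_i\pm f_i$ are convex on all of $\operatorname{dom}h_i$ (not only on its interior), then $\varphi\equiv\varphi_\star$ on $\omega$; 3. if $C=\mathbb R^n$, then $0\in\hat\partial\varphi(z^\star)$ for every $z^\star\in\omega$. -/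

import Mathlib

open Filter Topology Set

noncomputable section

namespace BFinito

/-- The Euclidean space of dimension `n`. -/
abbrev E (n : ℕ) : Type := EuclideanSpace ℝ (Fin n)

/-! ### Extended-real-valued functions -/

/-- The (effective) domain of an extended-real-valued function. -/
def dom {n : ℕ} (F : E n → EReal) : Set (E n) := {x | F x < ⊤}

/-- A function with values in the reals together with `+∞` that is not identically `+∞`. -/
def IsProper {n : ℕ} (F : E n → EReal) : Prop := (∀ x, F x ≠ ⊥) ∧ (dom F).Nonempty

/-- The minimizers of `F` over `S`; by the usual convention there are none
if `F` is identically `+∞` on `S`. -/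
def argminOn {n : ℕ} (F : E n → EReal) (S : Set (E n)) : Set (E n) :=
  {x | x ∈ S ∧ F x < ⊤ ∧ ∀ y ∈ S, F x ≤ F y}

/-- The gradient of `F` at a point in the interior of its domain. -/
def grad {n : ℕ} (F : E n → EReal) (x : E n) : E n := gradient (fun y => (F y).toReal) x

/-- The regular subdifferential of `F` at `x` (empty where `F` is not finite). -/
def regSubdiff {n : ℕ} (F : E n → EReal) (x : E n) : Set (E n) :=
  {v | F x ≠ ⊤ ∧ F x ≠ ⊥ ∧
    0 ≤ liminf (fun y => (F y - F x - ((inner ℝ v (y - x) : ℝ) : EReal)) /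
      ((‖y - x‖ : ℝ) : EReal)) (𝓝[≠] x)}

/-- The set of limit points (limits of subsequences) of a sequence. -/
def limitSet {n : ℕ} (u : ℕ → E n) : Set (E n) :=
  {x | ∃ κ : ℕ → ℕ, StrictMono κ ∧ Tendsto (fun j => u (κ j)) atTop (𝓝 x)}

/-! ### Bregman distances, Legendre kernels, relative smoothness -/

open Classical in
/-- The Bregman distance `D_h(x, y)`. -/
def bregman {n : ℕ} (h : E n → EReal) (x y : E n) : EReal :=
  if y ∈ interior (dom h) then h x - h y - ((inner ℝ (grad h y) (x - y) : ℝ) : EReal) else ⊤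

/-- Legendre kernels: proper, lsc, strictly convex, `C¹` on the nonempty interior of the domain,
1-coercive and essentially smooth. -/
structure IsLegendreKernel {n : ℕ} (h : E n → EReal) : Prop where
  proper : IsProper h
  lsc : LowerSemicontinuous h
  strictConvex : StrictConvexOn ℝ (dom h) (fun x => (h x).toReal)
  interior_nonempty : (interior (dom h)).Nonempty
  contDiffOn : ContDiffOn ℝ 1 (fun x => (h x).toReal) (interior (dom h))
  coercive : Tendsto (fun x => h x / ((‖x‖ : ℝ) : EReal)) (cocompact (E n)) (𝓝 ⊤)
  essentiallySmooth : ∀ (u : ℕ → E n) (x : E n), (∀ k, u k ∈ interior (dom h)) →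
    x ∈ frontier (dom h) → Tendsto u atTop (𝓝 x) →
      Tendsto (fun k => ‖grad h (u k)‖) atTop atTop

/-- `L h + f` and `L h - f` are convex on `S` (used for sets `S ⊆ dom h ⊆ dom f`, where all the
values are finite). -/
def TwoSidedConvexOn {n : ℕ} (S : Set (E n)) (L : ℝ) (f h : E n → EReal) : Prop :=
  ConvexOn ℝ S (fun x => L * (h x).toReal + (f x).toReal) ∧
  ConvexOn ℝ S (fun x => L * (h x).toReal - (f x).toReal)

/-- `f` is `L`-smooth relative to `h`. -/
structure IsRelSmooth {n : ℕ} (L : ℝ) (f h : E n → EReal) : Prop where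
  proper : IsProper f
  lsc : LowerSemicontinuous f
  dom_subset : dom h ⊆ dom f
  nonneg : 0 ≤ L
  convex : TwoSidedConvexOn (interior (dom h)) L f h

/-! ### The problem and the standing assumptions -/

/-- The open set `C`, intersection of the interiors of the domains of the kernels. -/
def Cset {n N : ℕ} (h : Fin N → E n → EReal) : Set (E n) := ⋂ i, interior (dom (h i))

/-- The cost `φ = (1/N) ∑ f_i + g`. -/
def cost {n N : ℕ} (f : Fin N → E n → EReal) (g : E n → EReal) (x : E n) : EReal :=
  ((1 / (N : ℝ) : ℝ) : EReal) * ∑ i, f i x + g x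

/-- The set-valued map `T(s) = argmin_w { g(w) + ∑ h_i(w)/γ_i - ⟨s, w⟩ }`. -/
def Tmap {n N : ℕ} (g : E n → EReal) (h : Fin N → E n → EReal) (γ : Fin N → ℝ) (s : E n) :
    Set (E n) :=
  argminOn (fun w => g w + ∑ i, ((1 / γ i : ℝ) : EReal) * h i w - ((inner ℝ s w : ℝ) : EReal))
    univ

/-- The basic requirements. The stepsize condition `γ_i < N / L_i` is written so that it means
`γ_i < ∞` if `L_i = 0`. -/
structure BasicAssumption {n N : ℕ} (f : Fin N → E n → EReal) (g : E n → EReal)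
    (h : Fin N → E n → EReal) (L γ : Fin N → ℝ) : Prop where
  legendre : ∀ i, IsLegendreKernel (h i)
  relSmooth : ∀ i, IsRelSmooth (L i) (f i) (h i)
  g_proper : IsProper g
  g_lsc : LowerSemicontinuous g
  solution : (argminOn (cost f g) (closure (Cset h))).Nonempty
  stepsize : ∀ i, 0 < γ i ∧ γ i * L i < N
  range_T : ∀ s, Tmap g h γ s ⊆ Cset h

/-- The requirement on a distance-generating function: its domain is closed and
`D_h(z, z^k) → 0` whenever interior points `z^k` converge to a boundary point `z`. -/
def BoundaryRegular {n : ℕ} (h : E n → EReal) : Prop :=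
  IsClosed (dom h) ∧ ∀ (u : ℕ → E n) (x : E n), (∀ k, u k ∈ interior (dom h)) →
    x ∈ frontier (dom h) → Tendsto u atTop (𝓝 x) →
      Tendsto (fun k => bregman h x (u k)) atTop (𝓝 0)

/-! ### The low-memory algorithm -/

/-- The vector `(1/γ_i) ∇h_i(x) - (1/N) ∇f_i(x)`. -/
def gradDiff {n N : ℕ} (f h : Fin N → E n → EReal) (γ : Fin N → ℝ) (i : Fin N) (x : E n) : E n :=
  (1 / γ i) • grad (h i) x - (1 / (N : ℝ)) • grad (f i) x

/-- `(s, z, zt, I, K)` is generated by the low-memory Bregman Finito/MISO algorithm started at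
`xinit`. Here `s k`, `z k`, `zt k`, `K k` stand for `s̃^k`, `z^k`, `z̃^k`, `K^k`, and `I (k + 1)`
for the set of indices sampled in iteration `k` (`I 0` plays no role). As `K 0 = ∅`, the case
`k = 0` never occurs in `step_partial`, so that `k - 1` there is the true predecessor. -/
structure IsLowMemoryRun {n N : ℕ} (f : Fin N → E n → EReal) (g : E n → EReal)
    (h : Fin N → E n → EReal) (γ : Fin N → ℝ) (xinit : E n)
    (s z zt : ℕ → E n) (I K : ℕ → Finset (Fin N)) : Prop where
  init_s : s 0 = ∑ i, gradDiff f h γ i xinit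
  init_K : K 0 = ∅
  z_mem : ∀ k, z k ∈ Tmap g h γ (s k)
  step_full : ∀ k, K k = ∅ →
    I (k + 1) = Finset.univ ∧ K (k + 1) = Finset.univ ∧ zt k = z k ∧
      s (k + 1) = ∑ i, gradDiff f h γ i (z k)
  step_partial : ∀ k, K k ≠ ∅ →
    (I (k + 1)).Nonempty ∧ I (k + 1) ⊆ K k ∧ K (k + 1) = K k \ I (k + 1) ∧
      zt k = zt (k - 1) ∧
      s (k + 1) = s k + ∑ i ∈ I (k + 1), (gradDiff f h γ i (z k) - gradDiff f h γ i (zt k))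

/-! ### The Bregman-Moreau envelope along the iterates -/

open Classical in
/-- The kernel `h_i/γ_i - f_i/N`, with the convention `∞ - ∞ = ∞`. -/
def hatKernel {n N : ℕ} (f h : Fin N → E n → EReal) (γ : Fin N → ℝ) (i : Fin N) (x : E n) :
    EReal :=
  if h i x = ⊤ then ⊤
  else ((1 / γ i : ℝ) : EReal) * h i x - ((1 / (N : ℝ) : ℝ) : EReal) * f i x

open Classical in
/-- The lifted cost on `N`-tuples: `(1/N) ∑ f_i(x_i) + (1/N) ∑ g(x_i)` plus the indicator function
of the consensus set. -/
def liftedCost {n N : ℕ} (f : Fin N → E n → EReal) (g : E n → EReal) (x : Fin N → E n) : EReal :=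
  ((1 / (N : ℝ) : ℝ) : EReal) * ∑ i, f i (x i) +
    (((1 / (N : ℝ) : ℝ) : EReal) * ∑ i, g (x i) + if ∀ i j, x i = x j then 0 else ⊤)

/-- The Bregman-Moreau envelope of the lifted cost relative to the separable kernel
`x ↦ ∑ i, (h_i/γ_i - f_i/N)(x_i)`, whose Bregman distance is the sum of those of its terms. -/
def envelope {n N : ℕ} (f : Fin N → E n → EReal) (g : E n → EReal) (h : Fin N → E n → EReal)
    (γ : Fin N → ℝ) (x : Fin N → E n) : EReal :=
  ⨅ w : Fin N → E n, liftedCost f g w + ∑ i, bregman (hatKernel f h γ i) (w i) (x i)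

open Classical in
/-- The block iterates: `x_i^k` is the point at which the `i`-th gradients were last evaluated. -/
def blockIterate {n N : ℕ} (xinit : E n) (z : ℕ → E n) (I : ℕ → Finset (Fin N)) :
    ℕ → Fin N → E n
  | 0 => fun _ => xinit
  | k + 1 => fun i => if i ∈ I (k + 1) then z k else blockIterate xinit z I k i

end BFinito

end

open BFinito

/-!
Each iterate `z k` minimizes `w ↦ φ(w) + ∑ D_i(w, x_i)`, where the `x_i` are the block iterates and
`D_i` is the Bregman distance of `ĥ_i = h_i/γ_i - f_i/N`: the vectors `s k` maintained by the
algorithm are the sums of the gradients `∇ĥ_i(x_i)` (`IsLowMemoryRun.s_eq`), and up to a constant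
`φ + ∑ D_i(·, x_i)` is then the objective in the definition of `T` at `s k`
(`BasicAssumption.costReal_add_hatDist_le`). Hence the envelope equals `φ(z k) + ∑ D_i(z k, x_i)`
(`IsLowMemoryRun.envelope_eq`). The step size condition gives `D_i ≥ 0`, so the envelope dominates
`φ(z k) ≥ inf_C φ`. Using `w = z k` as a competitor at the next block iterate, where the sampled
blocks are at distance zero, shows that the envelope decreases
(`IsLowMemoryRun.antitone_envelope`). Its limit is `φstar`.

That `∇ĥ_i = ∇h_i/γ_i - ∇f_i/N` needs `f_i` to be differentiable. This holds because `L h ± f` are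
convex with differentiable sum (`ConvexOn.differentiableAt_of_add`).

The points `zt k` are those of full steps `l`, after which all blocks are at `z l`. There the
envelope is at most `φ(w) + ∑ D_i(w, z l)` for every `w`. With `w = z l` this squeezes `φ(z l)`
between consecutive values of the envelope, and `l → ∞` since full steps recur within `N`
iterations. With `w` fixed and `z l` running along a subsequence that converges to `zstar`, it gives
`φstar ≤ φ(w) + lim ∑ D_i(w, z l)` (`IsLowMemoryRun.le_cost_add`). Here `|D_{f_i}| ≤ L_i D_{h_i}`
bounds `D_i` by a multiple of `D_{h_i}`, so that only the continuity of `∇h_i` is needed, not that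
of `∇f_i`. For `w = zstar` the limit is zero, and `φ(zstar) ≤ φstar` by lower semicontinuity. If
`C` is the whole space, the limit at a general `w` is bounded by a multiple of
`∑ D_{h_i}(w, zstar) = o(‖w - zstar‖)`, which makes `zstar` stationary.
-/

/-! ### Convex functions: gradient inequality, subgradients, differentiability -/

/-- The gradient inequality. -/
theorem ConvexOn.add_fderiv_le {F : Type*} [NormedAddCommGroup F] [NormedSpace ℝ F] {S : Set F}
    {u : F → ℝ} (hu : ConvexOn ℝ S u) {x y : F} (hx : x ∈ S) (hy : y ∈ S) {ℓ : F →L[ℝ] ℝ}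
    (hd : HasFDerivAt u ℓ y) : u y + ℓ (x - y) ≤ u x := by
  have hc : ConvexOn ℝ (AffineMap.lineMap y x ⁻¹' S) (u ∘ AffineMap.lineMap (k := ℝ) y x) :=
    hu.comp_affineMap _
  have hd' : HasDerivAt (u ∘ AffineMap.lineMap (k := ℝ) y x) (ℓ (x - y)) 0 := by
    refine HasFDerivAt.comp_hasDerivAt (0 : ℝ) ?_ AffineMap.hasDerivAt_lineMap
    simpa using hd
  have h := hc.le_slope_of_hasDerivAt (x := 0) (y := 1) (by simpa using hy) (by simpa using hx)
    one_pos hd'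
  simp [slope_def_field] at h
  rw [map_sub]
  linarith

/-- Separate `(x, u x)` from the strict epigraph, which is open because `u` is continuous. -/
theorem ConvexOn.exists_subgradient {F : Type*} [NormedAddCommGroup F] [NormedSpace ℝ F]
    [FiniteDimensional ℝ F] {S : Set F} (hS : IsOpen S) {u : F → ℝ} (hu : ConvexOn ℝ S u) {x : F}
    (hx : x ∈ S) : ∃ ℓ : F →L[ℝ] ℝ, ∀ y ∈ S, u x + ℓ (y - x) ≤ u y := by
  have hcont : ContinuousOn u S := hu.continuousOn hS
  have hopen : IsOpen {p : F × ℝ | p.1 ∈ S ∧ u p.1 < p.2} := by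
    have h1 : ContinuousOn (fun p : F × ℝ => p.2 - u p.1) (Prod.fst ⁻¹' S) :=
      continuousOn_snd.sub (hcont.comp continuousOn_fst fun p hp => hp)
    have h2 := h1.isOpen_inter_preimage (hS.preimage continuous_fst) (isOpen_Ioi (a := (0 : ℝ)))
    convert h2 using 1
    ext p
    simp
  obtain ⟨φ, hφ⟩ := geometric_hahn_banach_point_open (x := (x, u x)) hu.convex_strict_epigraph
    hopen (by simp)
  have hsplit : ∀ (y : F) (t : ℝ), φ (y, t) = φ (y, 0) + t * φ (0, 1) := fun y t => by
    rw [← smul_eq_mul, ← map_smul, ← map_add]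
    simp
  -- The vertical component of the separating functional is positive, so the separating
  -- hyperplane is not vertical.
  set c := φ (0, 1) with hc
  have hcpos : 0 < c := by
    have h := hφ (x, u x + 1) ⟨hx, by simp⟩
    rw [hsplit, hsplit x (u x + 1)] at h
    linarith
  refine ⟨-(c⁻¹ • φ.comp (ContinuousLinearMap.inl ℝ F ℝ)), fun y hy => ?_⟩
  have hle : φ (x, 0) + u x * c ≤ φ (y, 0) + u y * c := by
    refine le_of_forall_pos_le_add fun ε hε => ?_
    have h := hφ (y, u y + ε / c) ⟨hy, by simp; positivity⟩
    rw [hsplit, hsplit y (u y + ε / c), add_mul, div_mul_cancel₀ _ hcpos.ne'] at h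
    linarith
  have hsub : φ (y - x, 0) = φ (y, 0) - φ (x, 0) := by
    rw [← map_sub]
    simp
  have hmul : c * (u x + -(c⁻¹ * φ (y - x, 0))) ≤ c * u y := by
    rw [hsub]
    field_simp
    linarith
  simpa using le_of_mul_le_mul_left hmul hcpos

/-- The subgradients of the two summands add up to the derivative of the sum, so the first-order
error of either summand is squeezed between zero and that of the sum. -/
theorem ConvexOn.differentiableAt_of_add {F : Type*} [NormedAddCommGroup F] [NormedSpace ℝ F]
    [FiniteDimensional ℝ F] {S : Set F} (hS : IsOpen S) {u v : F → ℝ} (hu : ConvexOn ℝ S u)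
    (hv : ConvexOn ℝ S v) {x : F} (hx : x ∈ S) (hd : DifferentiableAt ℝ (fun y => u y + v y) x) :
    DifferentiableAt ℝ u x := by
  obtain ⟨ℓ, hℓ⟩ := hu.exists_subgradient hS hx
  obtain ⟨m, hm⟩ := hv.exists_subgradient hS hx
  obtain ⟨D, hD⟩ := hd
  have hmem : S ∈ 𝓝 x := hS.mem_nhds hx
  -- The affine minorant `ℓ + m` of `u + v` touches it at `x`, where `u + v` is differentiable.
  have hDeq : D = ℓ + m := by
    have hmin : IsLocalMin (fun y => u y + v y - (ℓ + m) y) x := by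
      filter_upwards [hmem] with y hy
      have h1 := hℓ y hy
      have h2 := hm y hy
      simp only [map_sub] at h1 h2
      simp only [add_apply]
      linarith
    exact sub_eq_zero.mp (hmin.hasFDerivAt_eq_zero (hD.sub (ℓ + m).hasFDerivAt))
  subst hDeq
  refine ⟨ℓ, ?_⟩
  rw [hasFDerivAt_iff_isLittleO] at hD ⊢
  refine Asymptotics.IsBigO.trans_isLittleO (Asymptotics.IsBigO.of_bound 1 ?_) hD
  filter_upwards [hmem] with y hy
  have h1 := hℓ y hy
  have h2 := hm y hy
  rw [one_mul, Real.norm_eq_abs, Real.norm_eq_abs, abs_of_nonneg (by linarith)]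
  refine le_trans ?_ (le_abs_self _)
  simp only [add_apply]
  linarith

/-! ### Extended-real sums and lower semicontinuity -/

theorem EReal.coe_finset_sum {ι : Type*} (s : Finset ι) (a : ι → ℝ) :
    ((∑ i ∈ s, a i : ℝ) : EReal) = ∑ i ∈ s, (a i : EReal) := by
  classical
  induction s using Finset.induction_on with
  | empty => simp
  | insert i s hi ih => rw [Finset.sum_insert hi, Finset.sum_insert hi, EReal.coe_add, ih]

theorem EReal.finset_sum_ne_bot {ι : Type*} (s : Finset ι) {a : ι → EReal} (ha : ∀ i, a i ≠ ⊥) :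
    ∑ i ∈ s, a i ≠ ⊥ :=
  Finset.sum_induction a (· ≠ ⊥) (fun _ _ h1 h2 => by simp [EReal.add_eq_bot_iff, h1, h2])
    (by simp) fun i _ => ha i

theorem EReal.finset_sum_eq_top {ι : Type*} {s : Finset ι} {a : ι → EReal} (ha : ∀ i, a i ≠ ⊥)
    {j : ι} (hj : j ∈ s) (hjt : a j = ⊤) : ∑ i ∈ s, a i = ⊤ := by
  classical
  rw [← Finset.add_sum_erase s a hj, hjt, EReal.top_add_of_ne_bot (EReal.finset_sum_ne_bot _ ha)]

theorem EReal.coe_mul_ne_bot {c : ℝ} (hc : 0 < c) {a : EReal} (ha : a ≠ ⊥) :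
    (c : EReal) * a ≠ ⊥ := by
  induction a using EReal.rec with
  | bot => exact absurd rfl ha
  | coe r => rw [← EReal.coe_mul]; exact EReal.coe_ne_bot _
  | top => rw [EReal.coe_mul_top_of_pos hc]; exact top_ne_bot

theorem EReal.monotone_coe_mul {c : ℝ} (hc : 0 ≤ c) : Monotone fun a : EReal => (c : EReal) * a :=
  fun _ _ h => mul_le_mul_of_nonneg_left h (EReal.coe_nonneg.mpr hc)

theorem LowerSemicontinuous.ereal_add {X : Type*} [TopologicalSpace X] {F G : X → EReal}
    (hF : LowerSemicontinuous F) (hG : LowerSemicontinuous G) (hF' : ∀ x, F x ≠ ⊥)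
    (hG' : ∀ x, G x ≠ ⊥) : LowerSemicontinuous fun x => F x + G x :=
  hF.add' hG fun x => EReal.continuousAt_add (Or.inr (hG' x)) (Or.inl (hF' x))

theorem LowerSemicontinuous.ereal_sum {X ι : Type*} [TopologicalSpace X] {F : ι → X → EReal}
    (hF : ∀ i, LowerSemicontinuous (F i)) (hF' : ∀ i x, F i x ≠ ⊥) (s : Finset ι) :
    LowerSemicontinuous fun x => ∑ i ∈ s, F i x := by
  classical
  induction s using Finset.induction_on with
  | empty => simpa using lowerSemicontinuous_const
  | insert i s hi ih =>
    simp only [Finset.sum_insert hi]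
    exact (hF i).ereal_add ih (hF' i) fun x => EReal.finset_sum_ne_bot _ fun j => hF' j x

theorem LowerSemicontinuous.ereal_const_mul {X : Type*} [TopologicalSpace X] {F : X → EReal}
    (hF : LowerSemicontinuous F) {c : ℝ} (hc : 0 < c) :
    LowerSemicontinuous fun x => (c : EReal) * F x := by
  have hcont : Continuous fun a : EReal => (c : EReal) * a := by
    rw [continuous_iff_continuousAt]
    intro a
    have hc' : (c : EReal) ≠ 0 := by exact_mod_cast hc.ne'
    exact ContinuousAt.comp (f := fun a : EReal => ((c : EReal), a))
      (EReal.continuousAt_mul (p := ((c : EReal), a)) (Or.inl hc') (Or.inl hc')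
        (Or.inl (EReal.coe_ne_bot c)) (Or.inl (EReal.coe_ne_top c)))
      (by fun_prop)
  exact hcont.comp_lowerSemicontinuous hF (EReal.monotone_coe_mul hc.le)

namespace BFinito

variable {n N : ℕ}

/-! ### Real-valued Bregman distances -/

/-- The Bregman distance of `F` computed with the real parts of the values of `F`. It agrees with
`bregman F x y` if `F` is finite at `x` and `y ∈ interior (dom F)`, and it makes sense for any `F`,
convex or not. -/
noncomputable def realBregman (F : E n → EReal) (x y : E n) : ℝ :=
  (F x).toReal - (F y).toReal - inner ℝ (grad F y) (x - y)

@[simp]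
theorem realBregman_self (F : E n → EReal) (x : E n) : realBregman F x x = 0 := by
  simp [realBregman]

theorem bregman_eq_coe {F : E n → EReal} (hF : ∀ x, F x ≠ ⊥) {x y : E n} (hx : F x ≠ ⊤)
    (hy : y ∈ interior (dom F)) : bregman F x y = (realBregman F x y : EReal) := by
  have hy' : F y ≠ ⊤ := (show y ∈ dom F from interior_subset hy).ne
  rw [bregman, if_pos hy, realBregman, EReal.coe_sub, EReal.coe_sub,
    EReal.coe_toReal hx (hF x), EReal.coe_toReal hy' (hF y)]

theorem IsLegendreKernel.hasGradientAt {h : E n → EReal} (hh : IsLegendreKernel h) {y : E n}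
    (hy : y ∈ interior (dom h)) : HasGradientAt (fun x => (h x).toReal) (grad h y) y :=
  ((hh.contDiffOn.differentiableOn one_ne_zero).differentiableAt
    (isOpen_interior.mem_nhds hy)).hasGradientAt

theorem IsLegendreKernel.continuousOn_grad {h : E n → EReal} (hh : IsLegendreKernel h) :
    ContinuousOn (grad h) (interior (dom h)) :=
  (LinearIsometryEquiv.continuous _).comp_continuousOn
    (hh.contDiffOn.continuousOn_fderiv_of_isOpen isOpen_interior le_rfl)

theorem IsLegendreKernel.continuousAt_realBregman {h : E n → EReal} (hh : IsLegendreKernel h)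
    (x : E n) {y : E n} (hy : y ∈ interior (dom h)) : ContinuousAt (realBregman h x) y := by
  have hmem := isOpen_interior.mem_nhds hy
  have h1 : ContinuousAt (fun y => (h y).toReal) y :=
    (hh.hasGradientAt hy).differentiableAt.continuousAt
  have h2 : ContinuousAt (grad h) y := hh.continuousOn_grad.continuousAt hmem
  exact (continuousAt_const.sub h1).sub (h2.inner (continuousAt_const.sub continuousAt_id))

theorem IsLegendreKernel.isLittleO_realBregman {h : E n → EReal} (hh : IsLegendreKernel h)
    {y : E n} (hy : y ∈ interior (dom h)) :
    (fun x => realBregman h x y) =o[𝓝 y] fun x => x - y :=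
  hasGradientAt_iff_isLittleO.mp (hh.hasGradientAt hy)

theorem IsLegendreKernel.realBregman_nonneg {h : E n → EReal} (hh : IsLegendreKernel h)
    {x y : E n} (hx : x ∈ dom h) (hy : y ∈ interior (dom h)) : 0 ≤ realBregman h x y := by
  have h1 := hh.strictConvex.convexOn.add_fderiv_le hx (interior_subset hy)
    (hh.hasGradientAt hy).hasFDerivAt
  rw [InnerProductSpace.toDual_apply_apply] at h1
  rw [realBregman]
  linarith

/-- `L h + f` and `L h - f` are convex and sum up to the differentiable function `2 L h`, so both
are differentiable. -/
theorem IsRelSmooth.hasGradientAt {L : ℝ} {f h : E n → EReal} (hf : IsRelSmooth L f h)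
    (hh : IsLegendreKernel h) {y : E n} (hy : y ∈ interior (dom h)) :
    HasGradientAt (fun x => (f x).toReal) (grad f y) y := by
  have hd : DifferentiableAt ℝ (fun x => (h x).toReal) y := (hh.hasGradientAt hy).differentiableAt
  have h1 : DifferentiableAt ℝ (fun x => L * (h x).toReal + (f x).toReal) y := by
    refine hf.convex.1.differentiableAt_of_add isOpen_interior hf.convex.2 hy ?_
    have heq : (fun x => L * (h x).toReal + (f x).toReal + (L * (h x).toReal - (f x).toReal)) =
        fun x => 2 * L * (h x).toReal := by
      funext x
      ring
    rw [heq]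
    exact hd.const_mul (2 * L)
  have heq : (fun x => (f x).toReal) =
      fun x => L * (h x).toReal + (f x).toReal - L * (h x).toReal := by
    funext x
    ring
  refine DifferentiableAt.hasGradientAt ?_
  rw [heq]
  exact h1.sub (hd.const_mul L)

/-- The gradient inequalities for `L h + f` and `L h - f` amount to `|D_f| ≤ L D_h`. -/
theorem TwoSidedConvexOn.abs_realBregman_le {S : Set (E n)} {L : ℝ} {f h : E n → EReal}
    (hS : TwoSidedConvexOn S L f h) {x y : E n} (hx : x ∈ S) (hy : y ∈ S)
    (hfy : HasGradientAt (fun x => (f x).toReal) (grad f y) y)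
    (hhy : HasGradientAt (fun x => (h x).toReal) (grad h y) y) :
    |realBregman f x y| ≤ L * realBregman h x y := by
  have h1 := hS.1.add_fderiv_le hx hy ((hhy.hasFDerivAt.const_mul L).add hfy.hasFDerivAt)
  have h2 := hS.2.add_fderiv_le hx hy ((hhy.hasFDerivAt.const_mul L).sub hfy.hasFDerivAt)
  simp only [add_apply, sub_apply, smul_apply, smul_eq_mul,
    InnerProductSpace.toDual_apply_apply] at h1 h2
  rw [abs_le, realBregman, realBregman]
  constructor <;> linarith

/-- The Bregman distance of the kernel `h_i/γ_i - f_i/N`, written as a combination of those of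
`h_i` and `f_i`; `bregman_hatKernel` identifies it with `bregman` of that kernel. -/
noncomputable def hatDist (f h : Fin N → E n → EReal) (γ : Fin N → ℝ) (i : Fin N) (x y : E n) : ℝ :=
  1 / γ i * realBregman (h i) x y - 1 / (N : ℝ) * realBregman (f i) x y

@[simp]
theorem hatDist_self (f h : Fin N → E n → EReal) (γ : Fin N → ℝ) (i : Fin N) (x : E n) :
    hatDist f h γ i x x = 0 := by
  simp [hatDist]

theorem hatDist_le {f h : Fin N → E n → EReal} {γ : Fin N → ℝ} {i : Fin N} {L : ℝ} {x y : E n}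
    (hxy : |realBregman (f i) x y| ≤ L * realBregman (h i) x y) :
    hatDist f h γ i x y ≤ (1 / γ i + L / N) * realBregman (h i) x y := by
  have h1 : 1 / (N : ℝ) * -realBregman (f i) x y ≤ 1 / (N : ℝ) * (L * realBregman (h i) x y) :=
    mul_le_mul_of_nonneg_left ((neg_le_abs _).trans hxy) (by positivity)
  have h2 : L / N * realBregman (h i) x y = 1 / (N : ℝ) * (L * realBregman (h i) x y) := by ring
  rw [hatDist, add_mul]
  linarith

namespace BasicAssumption

variable {f : Fin N → E n → EReal} {g : E n → EReal} {h : Fin N → E n → EReal} {L γ : Fin N → ℝ}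

theorem h_ne_bot (hb : BasicAssumption f g h L γ) (i : Fin N) (x : E n) : h i x ≠ ⊥ :=
  (hb.legendre i).proper.1 x

theorem f_ne_bot (hb : BasicAssumption f g h L γ) (i : Fin N) (x : E n) : f i x ≠ ⊥ :=
  (hb.relSmooth i).proper.1 x

theorem f_ne_top (hb : BasicAssumption f g h L γ) {i : Fin N} {x : E n} (hx : x ∈ dom (h i)) :
    f i x ≠ ⊤ :=
  ne_of_lt ((hb.relSmooth i).dom_subset hx)

theorem abs_realBregman_le (hb : BasicAssumption f g h L γ) {i : Fin N} {S : Set (E n)}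
    (hS : TwoSidedConvexOn S (L i) (f i) (h i)) {x y : E n} (hx : x ∈ S) (hyS : y ∈ S)
    (hy : y ∈ interior (dom (h i))) :
    |realBregman (f i) x y| ≤ L i * realBregman (h i) x y :=
  hS.abs_realBregman_le hx hyS ((hb.relSmooth i).hasGradientAt (hb.legendre i) hy)
    ((hb.legendre i).hasGradientAt hy)

/-- The stepsize condition `1/γ_i > L_i/N` makes the kernel `h_i/γ_i - f_i/N` convex. -/
theorem hatDist_nonneg (hb : BasicAssumption f g h L γ) (hN : 0 < N) {i : Fin N} {x y : E n}
    (hx : x ∈ interior (dom (h i))) (hy : y ∈ interior (dom (h i))) :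
    0 ≤ hatDist f h γ i x y := by
  have hN' : (0 : ℝ) < N := by exact_mod_cast hN
  obtain ⟨hγ, hγL⟩ := hb.stepsize i
  have h1 := (le_abs_self _).trans (hb.abs_realBregman_le (hb.relSmooth i).convex hx hy hy)
  have h2 := (hb.legendre i).realBregman_nonneg (interior_subset hx) hy
  have h3 : L i / N ≤ 1 / γ i := by
    rw [div_le_div_iff₀ hN' hγ]
    linarith
  have h4 := mul_le_mul_of_nonneg_right h3 h2
  have h5 := mul_le_mul_of_nonneg_left h1 (one_div_pos.mpr hN').le
  rw [hatDist]
  have h6 : L i / N * realBregman (h i) x y = 1 / (N : ℝ) * (L i * realBregman (h i) x y) := by ring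
  linarith

/-! ### The kernels `h_i/γ_i - f_i/N` -/

theorem hatKernel_eq_coe (hb : BasicAssumption f g h L γ) {i : Fin N} {x : E n}
    (hx : x ∈ dom (h i)) :
    hatKernel f h γ i x =
      ((1 / γ i * (h i x).toReal - 1 / (N : ℝ) * (f i x).toReal : ℝ) : EReal) := by
  have hx' : h i x ≠ ⊤ := ne_of_lt hx
  rw [hatKernel, if_neg hx', EReal.coe_sub, EReal.coe_mul, EReal.coe_mul,
    EReal.coe_toReal hx' (hb.h_ne_bot i x), EReal.coe_toReal (hb.f_ne_top hx) (hb.f_ne_bot i x)]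

theorem hatKernel_ne_bot (hb : BasicAssumption f g h L γ) (i : Fin N) (x : E n) :
    hatKernel f h γ i x ≠ ⊥ := by
  by_cases hx : h i x = ⊤
  · simp [hatKernel, hx]
  · rw [hb.hatKernel_eq_coe (lt_top_iff_ne_top.mpr hx)]
    exact EReal.coe_ne_bot _

theorem dom_hatKernel (hb : BasicAssumption f g h L γ) (i : Fin N) :
    dom (hatKernel f h γ i) = dom (h i) := by
  ext x
  by_cases hx : h i x = ⊤
  · simp [dom, hatKernel, hx]
  · have hx' : x ∈ dom (h i) := lt_top_iff_ne_top.mpr hx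
    refine iff_of_true ?_ hx'
    change hatKernel f h γ i x < ⊤
    rw [hb.hatKernel_eq_coe hx']
    exact EReal.coe_lt_top _

theorem grad_hatKernel (hb : BasicAssumption f g h L γ) {i : Fin N} {y : E n}
    (hy : y ∈ interior (dom (h i))) : grad (hatKernel f h γ i) y = gradDiff f h γ i y := by
  have h1 : (fun x => (hatKernel f h γ i x).toReal) =ᶠ[𝓝 y]
      fun x => 1 / γ i * (h i x).toReal - 1 / (N : ℝ) * (f i x).toReal := by
    filter_upwards [mem_interior_iff_mem_nhds.mp hy] with x hx
    rw [hb.hatKernel_eq_coe hx, EReal.toReal_coe]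
  have h2 := (((hb.legendre i).hasGradientAt hy).hasFDerivAt.const_mul (1 / γ i)).sub
    (((hb.relSmooth i).hasGradientAt (hb.legendre i) hy).hasFDerivAt.const_mul (1 / (N : ℝ)))
  have h3 : InnerProductSpace.toDual ℝ (E n) (gradDiff f h γ i y) =
      (1 / γ i) • InnerProductSpace.toDual ℝ (E n) (grad (h i) y) -
        (1 / (N : ℝ)) • InnerProductSpace.toDual ℝ (E n) (grad (f i) y) := by
    ext v
    simp [gradDiff]
  rw [grad, h1.gradient_eq]
  refine HasGradientAt.gradient ?_
  rw [hasGradientAt_iff_hasFDerivAt, h3]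
  exact h2

theorem bregman_hatKernel (hb : BasicAssumption f g h L γ) {i : Fin N} {x y : E n}
    (hx : x ∈ dom (h i)) (hy : y ∈ interior (dom (h i))) :
    bregman (hatKernel f h γ i) x y = (hatDist f h γ i x y : EReal) := by
  rw [bregman_eq_coe (hb.hatKernel_ne_bot i)
    (by rw [hb.hatKernel_eq_coe hx]; exact EReal.coe_ne_top _)
    (by rwa [hb.dom_hatKernel]), realBregman, hb.grad_hatKernel hy, hb.hatKernel_eq_coe hx,
    hb.hatKernel_eq_coe (interior_subset hy), gradDiff, inner_sub_left, real_inner_smul_left,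
    real_inner_smul_left, hatDist, realBregman, realBregman, EReal.toReal_coe, EReal.toReal_coe]
  congr 1
  ring

theorem bregman_hatKernel_ne_bot (hb : BasicAssumption f g h L γ) (i : Fin N) (x y : E n) :
    bregman (hatKernel f h γ i) x y ≠ ⊥ := by
  by_cases hy : y ∈ interior (dom (h i))
  · by_cases hx : h i x = ⊤
    · rw [bregman, if_pos (by rwa [hb.dom_hatKernel]), hb.hatKernel_eq_coe (interior_subset hy),
        hatKernel, if_pos hx, EReal.top_sub_coe, EReal.top_sub_coe]
      exact top_ne_bot
    · rw [hb.bregman_hatKernel (lt_top_iff_ne_top.mpr hx) hy]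
      exact EReal.coe_ne_bot _
  · rw [bregman, if_neg (by rwa [hb.dom_hatKernel])]
    exact top_ne_bot

theorem bregman_hatKernel_eq_top (hb : BasicAssumption f g h L γ) {i : Fin N} {x y : E n}
    (hx : x ∉ dom (h i)) : bregman (hatKernel f h γ i) x y = ⊤ := by
  have hx' : h i x = ⊤ := by simpa [dom] using hx
  by_cases hy : y ∈ interior (dom (h i))
  · rw [bregman, if_pos (by rwa [hb.dom_hatKernel]), hb.hatKernel_eq_coe (interior_subset hy),
      hatKernel, if_pos hx', EReal.top_sub_coe, EReal.top_sub_coe]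
  · rw [bregman, if_neg (by rwa [hb.dom_hatKernel])]

end BasicAssumption
/-! ### The cost and the envelope -/

/-- The cost computed with the real parts of the values of its terms. It is the cost wherever these
values are finite. -/
noncomputable def costReal (f : Fin N → E n → EReal) (g : E n → EReal) (w : E n) : ℝ :=
  1 / (N : ℝ) * ∑ i, (f i w).toReal + (g w).toReal

theorem Cset_subset_dom {h : Fin N → E n → EReal} {w : E n} (hw : w ∈ Cset h) (i : Fin N) :
    w ∈ dom (h i) :=
  interior_subset (mem_iInter.mp hw i)

namespace BasicAssumption

variable {f : Fin N → E n → EReal} {g : E n → EReal} {h : Fin N → E n → EReal} {L γ : Fin N → ℝ}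

theorem mean_f_eq_coe (hb : BasicAssumption f g h L γ) {w : E n} (hw : ∀ i, w ∈ dom (h i)) :
    ((1 / (N : ℝ) : ℝ) : EReal) * ∑ i, f i w =
      ((1 / (N : ℝ) * ∑ i, (f i w).toReal : ℝ) : EReal) := by
  rw [EReal.coe_mul, EReal.coe_finset_sum]
  congr 1
  exact Finset.sum_congr rfl fun i _ =>
    (EReal.coe_toReal (hb.f_ne_top (hw i)) (hb.f_ne_bot i w)).symm

theorem cost_eq_coe (hb : BasicAssumption f g h L γ) {w : E n} (hw : ∀ i, w ∈ dom (h i))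
    (hg : g w ≠ ⊤) : cost f g w = (costReal f g w : EReal) := by
  rw [cost, hb.mean_f_eq_coe hw, costReal, EReal.coe_add, EReal.coe_toReal hg (hb.g_proper.1 w)]

theorem mean_f_ne_bot (hb : BasicAssumption f g h L γ) (hN : 0 < N) (w : Fin N → E n) :
    ((1 / (N : ℝ) : ℝ) : EReal) * ∑ i, f i (w i) ≠ ⊥ :=
  EReal.coe_mul_ne_bot (by positivity)
    (EReal.finset_sum_ne_bot (a := fun i => f i (w i)) _ fun i => hb.f_ne_bot i (w i))

theorem cost_eq_top (hb : BasicAssumption f g h L γ) (hN : 0 < N) {w : E n} (hg : g w = ⊤) :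
    cost f g w = ⊤ := by
  rw [cost, hg, EReal.add_top_of_ne_bot (hb.mean_f_ne_bot hN fun _ => w)]

theorem cost_ne_bot (hb : BasicAssumption f g h L γ) (hN : 0 < N) (w : E n) : cost f g w ≠ ⊥ := by
  rw [cost, Ne, EReal.add_eq_bot_iff, not_or]
  exact ⟨hb.mean_f_ne_bot hN fun _ => w, hb.g_proper.1 w⟩

theorem lowerSemicontinuous_cost (hb : BasicAssumption f g h L γ) (hN : 0 < N) :
    LowerSemicontinuous (cost f g) :=
  ((LowerSemicontinuous.ereal_sum (fun i => (hb.relSmooth i).lsc) (fun i => hb.f_ne_bot i)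
    Finset.univ).ereal_const_mul (by positivity)).ereal_add hb.g_lsc
    (fun w => hb.mean_f_ne_bot hN fun _ => w) hb.g_proper.1

theorem liftedCost_const (hb : BasicAssumption f g h L γ) (hN : 0 < N) (w : E n) :
    liftedCost f g (fun _ => w) = cost f g w := by
  have hN' : (N : ℝ) ≠ 0 := by exact_mod_cast hN.ne'
  have hpos : (0 : ℝ) < 1 / N := by positivity
  rw [liftedCost, if_pos fun _ _ => rfl, add_zero, cost]
  congr 1
  by_cases hg : g w = ⊤
  · rw [hg, EReal.finset_sum_eq_top (a := fun _ : Fin N => (⊤ : EReal)) (fun _ => top_ne_bot)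
      (Finset.mem_univ ⟨0, hN⟩) rfl, EReal.coe_mul_top_of_pos hpos]
  · rw [← EReal.coe_toReal hg (hb.g_proper.1 w), ← EReal.coe_finset_sum, ← EReal.coe_mul]
    congr 1
    simp
    field_simp

theorem liftedCost_ne_bot (hb : BasicAssumption f g h L γ) (hN : 0 < N) (w : Fin N → E n) :
    liftedCost f g w ≠ ⊥ := by
  rw [liftedCost, Ne, EReal.add_eq_bot_iff, EReal.add_eq_bot_iff, not_or, not_or]
  refine ⟨hb.mean_f_ne_bot hN w, EReal.coe_mul_ne_bot (by positivity)
    (EReal.finset_sum_ne_bot (a := fun i => g (w i)) _ fun i => hb.g_proper.1 (w i)), ?_⟩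
  split_ifs <;> simp

theorem liftedCost_eq_top (hb : BasicAssumption f g h L γ) (hN : 0 < N) {w : Fin N → E n}
    (hw : ¬∀ i j, w i = w j) : liftedCost f g w = ⊤ := by
  rw [liftedCost, if_neg hw, EReal.add_top_of_ne_bot (EReal.coe_mul_ne_bot (by positivity)
    (EReal.finset_sum_ne_bot (a := fun i => g (w i)) _ fun i => hb.g_proper.1 (w i))),
    EReal.add_top_of_ne_bot (hb.mean_f_ne_bot hN w)]

theorem envelope_le (hb : BasicAssumption f g h L γ) (hN : 0 < N) {x : Fin N → E n}
    (hx : ∀ i, x i ∈ interior (dom (h i))) {w : E n} (hw : ∀ i, w ∈ dom (h i)) :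
    envelope f g h γ x ≤ cost f g w + ((∑ i, hatDist f h γ i w (x i) : ℝ) : EReal) := by
  refine (iInf_le _ fun _ => w).trans (le_of_eq ?_)
  rw [hb.liftedCost_const hN w, EReal.coe_finset_sum]
  congr 1
  exact Finset.sum_congr rfl fun i _ => hb.bregman_hatKernel (hw i) (hx i)

theorem g_ne_top_of_mem_Tmap (hb : BasicAssumption f g h L γ) {s z : E n}
    (hz : z ∈ Tmap g h γ s) : g z ≠ ⊤ := by
  intro hg
  have hlt := hz.2.1
  have hsum : ∑ i, ((1 / γ i : ℝ) : EReal) * h i z ≠ ⊥ :=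
    EReal.finset_sum_ne_bot _ fun i =>
      EReal.coe_mul_ne_bot (one_div_pos.mpr (hb.stepsize i).1) (hb.h_ne_bot i z)
  simp only [hg, EReal.top_add_of_ne_bot hsum, EReal.top_sub_coe] at hlt
  exact lt_irrefl _ hlt

/-- The objective in the definition of `T(∑ p_i(x_i))` is the cost plus the Bregman distances
to the points `x_i`, up to a constant. -/
theorem costReal_add_hatDist_le (hb : BasicAssumption f g h L γ) {x : Fin N → E n}
    {z : E n} (hz : z ∈ Tmap g h γ (∑ i, gradDiff f h γ i (x i)))
    {w : E n} (hw : ∀ i, w ∈ dom (h i)) (hg : g w ≠ ⊤) :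
    costReal f g z + ∑ i, hatDist f h γ i z (x i) ≤
      costReal f g w + ∑ i, hatDist f h γ i w (x i) := by
  have hobj : ∀ v : E n, (∀ i, v ∈ dom (h i)) → g v ≠ ⊤ → ∀ s : E n,
      g v + ∑ i, ((1 / γ i : ℝ) : EReal) * h i v - ((inner ℝ s v : ℝ) : EReal) =
        (((g v).toReal + ∑ i, 1 / γ i * (h i v).toReal - inner ℝ s v : ℝ) : EReal) := by
    intro v hv hgv s
    rw [EReal.coe_sub, EReal.coe_add, EReal.coe_toReal hgv (hb.g_proper.1 v), EReal.coe_finset_sum]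
    congr 2
    refine Finset.sum_congr rfl fun i _ => ?_
    rw [EReal.coe_mul, EReal.coe_toReal (show v ∈ dom (h i) from hv i).ne (hb.h_ne_bot i v)]
  have hle := hz.2.2 w (mem_univ w)
  simp only at hle
  rw [hobj z (Cset_subset_dom (hb.range_T _ hz)) (hb.g_ne_top_of_mem_Tmap hz), hobj w hw hg,
    EReal.coe_le_coe_iff] at hle
  -- The last sum is the constant: it does not involve `v`.
  have hsplit : ∀ v : E n, costReal f g v + ∑ i, hatDist f h γ i v (x i) =
      ((g v).toReal + ∑ i, 1 / γ i * (h i v).toReal -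
        inner ℝ (∑ i, gradDiff f h γ i (x i)) v) +
      ∑ i, (inner ℝ (gradDiff f h γ i (x i)) (x i) -
        1 / γ i * (h i (x i)).toReal + 1 / (N : ℝ) * (f i (x i)).toReal) := by
    intro v
    rw [sum_inner, costReal, Finset.mul_sum, add_right_comm, ← Finset.sum_add_distrib,
      add_sub_assoc, ← Finset.sum_sub_distrib, add_assoc, ← Finset.sum_add_distrib, add_comm]
    congr 1
    refine Finset.sum_congr rfl fun i _ => ?_
    simp only [hatDist, realBregman, gradDiff, inner_sub_left, inner_sub_right,
      real_inner_smul_left]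
    ring
  rw [hsplit z, hsplit w]
  linarith

/-- The envelope is attained at the points of `T`. -/
theorem envelope_eq (hb : BasicAssumption f g h L γ) (hN : 0 < N) {x : Fin N → E n}
    (hx : ∀ i, x i ∈ interior (dom (h i))) {z : E n}
    (hz : z ∈ Tmap g h γ (∑ i, gradDiff f h γ i (x i))) :
    envelope f g h γ x = ((costReal f g z + ∑ i, hatDist f h γ i z (x i) : ℝ) : EReal) := by
  have hzd := Cset_subset_dom (hb.range_T _ hz)
  refine le_antisymm ?_ (le_iInf fun w => ?_)
  · rw [EReal.coe_add, ← hb.cost_eq_coe hzd (hb.g_ne_top_of_mem_Tmap hz)]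
    exact hb.envelope_le hN hx hzd
  · have hsum : ∑ i, bregman (hatKernel f h γ i) (w i) (x i) ≠ ⊥ :=
      EReal.finset_sum_ne_bot (a := fun i => bregman (hatKernel f h γ i) (w i) (x i)) _ fun i =>
        hb.bregman_hatKernel_ne_bot i _ _
    by_cases hconst : ∀ i j, w i = w j
    · obtain ⟨v, rfl⟩ : ∃ v, w = fun _ => v := ⟨w ⟨0, hN⟩, funext fun i => hconst _ _⟩
      by_cases hv : ∀ i, v ∈ dom (h i)
      · rw [hb.liftedCost_const hN v]
        by_cases hg : g v = ⊤
        · rw [hb.cost_eq_top hN hg, EReal.top_add_of_ne_bot hsum]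
          exact le_top
        · rw [hb.cost_eq_coe hv hg,
            Finset.sum_congr rfl fun i _ => hb.bregman_hatKernel (hv i) (hx i),
            ← EReal.coe_finset_sum, ← EReal.coe_add, EReal.coe_le_coe_iff]
          exact hb.costReal_add_hatDist_le hz hv hg
      · obtain ⟨i, hi⟩ := not_forall.mp hv
        rw [EReal.finset_sum_eq_top (a := fun i => bregman (hatKernel f h γ i) v (x i))
          (fun i => hb.bregman_hatKernel_ne_bot i _ _) (Finset.mem_univ i)
          (hb.bregman_hatKernel_eq_top hi),
          EReal.add_top_of_ne_bot (hb.liftedCost_ne_bot hN _)]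
        exact le_top
    · rw [hb.liftedCost_eq_top hN hconst, EReal.top_add_of_ne_bot hsum]
      exact le_top

end BasicAssumption
/-! ### Runs of the algorithm -/

theorem blockIterate_succ_of_mem {xinit : E n} {z : ℕ → E n} {I : ℕ → Finset (Fin N)} {k : ℕ}
    {i : Fin N} (hi : i ∈ I (k + 1)) : blockIterate xinit z I (k + 1) i = z k := by
  simp only [blockIterate, if_pos hi]

theorem blockIterate_succ_of_notMem {xinit : E n} {z : ℕ → E n} {I : ℕ → Finset (Fin N)} {k : ℕ}
    {i : Fin N} (hi : i ∉ I (k + 1)) :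
    blockIterate xinit z I (k + 1) i = blockIterate xinit z I k i := by
  simp only [blockIterate, if_neg hi]

namespace IsLowMemoryRun

variable {f : Fin N → E n → EReal} {g : E n → EReal} {h : Fin N → E n → EReal} {L γ : Fin N → ℝ}
  {xinit : E n} {s z zt : ℕ → E n} {I K : ℕ → Finset (Fin N)}

/-- The indices in `K k` have not been sampled since the last full step. -/
theorem blockIterate_eq_of_mem_K (hr : IsLowMemoryRun f g h γ xinit s z zt I K) (k : ℕ) :
    ∀ i ∈ K k, blockIterate xinit z I k i = zt (k - 1) := by
  induction k with
  | zero => simp [hr.init_K]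
  | succ k ih =>
    intro i hi
    rw [Nat.add_sub_cancel]
    by_cases hK : K k = ∅
    · obtain ⟨hI, -, hzt, -⟩ := hr.step_full k hK
      rw [blockIterate_succ_of_mem (by rw [hI]; exact Finset.mem_univ i), hzt]
    · obtain ⟨-, -, hK', hzt, -⟩ := hr.step_partial k hK
      rw [hK', Finset.mem_sdiff] at hi
      rw [blockIterate_succ_of_notMem hi.2, ih i hi.1, hzt]

/-- The vectors `s k` aggregate the gradients at the block iterates, although the algorithm does
not store these. -/
theorem s_eq (hr : IsLowMemoryRun f g h γ xinit s z zt I K) (k : ℕ) :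
    s k = ∑ i, gradDiff f h γ i (blockIterate xinit z I k i) := by
  induction k with
  | zero => exact hr.init_s
  | succ k ih =>
    by_cases hK : K k = ∅
    · obtain ⟨hI, -, -, hs⟩ := hr.step_full k hK
      rw [hs]
      refine Finset.sum_congr rfl fun i _ => ?_
      rw [blockIterate_succ_of_mem (by rw [hI]; exact Finset.mem_univ i)]
    · obtain ⟨-, hI, -, hzt, hs⟩ := hr.step_partial k hK
      have hext : ∑ i ∈ I (k + 1), (gradDiff f h γ i (z k) - gradDiff f h γ i (zt k)) =
          ∑ i, (gradDiff f h γ i (blockIterate xinit z I (k + 1) i) -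
            gradDiff f h γ i (blockIterate xinit z I k i)) := by
        rw [← Finset.sum_subset (Finset.subset_univ (I (k + 1))) fun i _ hi => by
          rw [blockIterate_succ_of_notMem hi, sub_self]]
        refine Finset.sum_congr rfl fun i hi => ?_
        rw [blockIterate_succ_of_mem hi, hr.blockIterate_eq_of_mem_K k i (hI hi), hzt]
      rw [hs, ih, hext, Finset.sum_sub_distrib]
      abel

/-- The point `zt k` stems from a full step `l`, at most `N` iterations before `k`: between
full steps the set `K` loses an index in each iteration. -/
theorem exists_full_step (hr : IsLowMemoryRun f g h γ xinit s z zt I K) (k : ℕ) :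
    ∃ l, K l = ∅ ∧ zt k = z l ∧ k + (K (k + 1)).card ≤ N + l := by
  induction k with
  | zero =>
    obtain ⟨-, hK', hzt, -⟩ := hr.step_full 0 hr.init_K
    exact ⟨0, hr.init_K, hzt, by simp [hK']⟩
  | succ k ih =>
    by_cases hK : K (k + 1) = ∅
    · obtain ⟨-, hK', hzt, -⟩ := hr.step_full (k + 1) hK
      exact ⟨k + 1, hK, hzt, by rw [hK', Finset.card_univ, Fintype.card_fin, add_comm]⟩
    · obtain ⟨hne, hI, hK', hzt, -⟩ := hr.step_partial (k + 1) hK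
      obtain ⟨l, hl, hzl, hcard⟩ := ih
      refine ⟨l, hl, by rw [hzt, Nat.add_sub_cancel, hzl], ?_⟩
      have h1 : (K (k + 1 + 1)).card < (K (k + 1)).card := by
        rw [hK']
        exact Finset.card_lt_card (Finset.sdiff_ssubset hI hne)
      omega

theorem z_mem_Cset (hr : IsLowMemoryRun f g h γ xinit s z zt I K)
    (hb : BasicAssumption f g h L γ) (k : ℕ) : z k ∈ Cset h :=
  hb.range_T _ (hr.z_mem k)

theorem blockIterate_mem (hr : IsLowMemoryRun f g h γ xinit s z zt I K)
    (hb : BasicAssumption f g h L γ) (hxinit : xinit ∈ Cset h) (k : ℕ) (i : Fin N) :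
    blockIterate xinit z I k i ∈ interior (dom (h i)) := by
  induction k with
  | zero => exact mem_iInter.mp hxinit i
  | succ k ih =>
    simp only [blockIterate]
    split_ifs
    · exact mem_iInter.mp (hr.z_mem_Cset hb k) i
    · exact ih

theorem cost_z_eq (hr : IsLowMemoryRun f g h γ xinit s z zt I K)
    (hb : BasicAssumption f g h L γ) (k : ℕ) : cost f g (z k) = (costReal f g (z k) : EReal) :=
  hb.cost_eq_coe (Cset_subset_dom (hr.z_mem_Cset hb k)) (hb.g_ne_top_of_mem_Tmap (hr.z_mem k))

/-- The envelope at the `k`-th block iterate is finite and attained at `z k`. -/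
theorem envelope_eq (hr : IsLowMemoryRun f g h γ xinit s z zt I K)
    (hb : BasicAssumption f g h L γ) (hN : 0 < N) (hxinit : xinit ∈ Cset h) (k : ℕ) :
    envelope f g h γ (blockIterate xinit z I k) = ((costReal f g (z k) +
      ∑ i, hatDist f h γ i (z k) (blockIterate xinit z I k i) : ℝ) : EReal) :=
  hb.envelope_eq hN (hr.blockIterate_mem hb hxinit k) (hr.s_eq k ▸ hr.z_mem k)

theorem cost_z_le_envelope (hr : IsLowMemoryRun f g h γ xinit s z zt I K)
    (hb : BasicAssumption f g h L γ) (hN : 0 < N) (hxinit : xinit ∈ Cset h) (k : ℕ) :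
    cost f g (z k) ≤ envelope f g h γ (blockIterate xinit z I k) := by
  rw [hr.envelope_eq hb hN hxinit, hr.cost_z_eq hb, EReal.coe_le_coe_iff]
  exact le_add_of_nonneg_right (Finset.sum_nonneg fun i _ => hb.hatDist_nonneg hN
    (mem_iInter.mp (hr.z_mem_Cset hb k) i) (hr.blockIterate_mem hb hxinit k i))

/-- Testing the envelope at the new block iterate with `w = z k` replaces the distances of the
sampled blocks by zero. -/
theorem antitone_envelope (hr : IsLowMemoryRun f g h γ xinit s z zt I K)
    (hb : BasicAssumption f g h L γ) (hN : 0 < N) (hxinit : xinit ∈ Cset h) :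
    Antitone fun k => envelope f g h γ (blockIterate xinit z I k) := by
  refine antitone_nat_of_succ_le fun k => ?_
  have h1 := hb.envelope_le hN (hr.blockIterate_mem hb hxinit (k + 1))
    (Cset_subset_dom (hr.z_mem_Cset hb k))
  refine h1.trans ?_
  rw [hr.envelope_eq hb hN hxinit, hr.cost_z_eq hb, ← EReal.coe_add, EReal.coe_le_coe_iff]
  refine add_le_add_right (Finset.sum_le_sum fun i _ => ?_) _
  by_cases hi : i ∈ I (k + 1)
  · rw [blockIterate_succ_of_mem hi, hatDist_self]
    exact hb.hatDist_nonneg hN (mem_iInter.mp (hr.z_mem_Cset hb k) i)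
      (hr.blockIterate_mem hb hxinit k i)
  · rw [blockIterate_succ_of_notMem hi]

theorem envelope_zero_le (hr : IsLowMemoryRun f g h γ xinit s z zt I K)
    (hb : BasicAssumption f g h L γ) (hN : 0 < N) (hxinit : xinit ∈ Cset h) :
    envelope f g h γ (blockIterate xinit z I 0) ≤ cost f g xinit := by
  have h1 := hb.envelope_le hN (hr.blockIterate_mem hb hxinit 0) (Cset_subset_dom hxinit)
  simpa [blockIterate] using h1

theorem blockIterate_succ_full (hr : IsLowMemoryRun f g h γ xinit s z zt I K) {l : ℕ}
    (hl : K l = ∅) : blockIterate xinit z I (l + 1) = fun _ => z l := by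
  funext i
  rw [blockIterate_succ_of_mem (by rw [(hr.step_full l hl).1]; exact Finset.mem_univ i)]

/-- After a full step all blocks coincide, so the envelope is below the cost there. -/
theorem envelope_succ_full_le (hr : IsLowMemoryRun f g h γ xinit s z zt I K)
    (hb : BasicAssumption f g h L γ) (hN : 0 < N) (hxinit : xinit ∈ Cset h) {l : ℕ}
    (hl : K l = ∅) {w : E n} (hw : ∀ i, w ∈ dom (h i)) :
    envelope f g h γ (blockIterate xinit z I (l + 1)) ≤
      cost f g w + ((∑ i, hatDist f h γ i w (z l) : ℝ) : EReal) := by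
  have h1 := hb.envelope_le hN (hr.blockIterate_mem hb hxinit (l + 1)) hw
  rwa [hr.blockIterate_succ_full hl] at h1 ⊢

theorem envelope_bounds (hr : IsLowMemoryRun f g h γ xinit s z zt I K)
    (hb : BasicAssumption f g h L γ) (hN : 0 < N) (hxinit : xinit ∈ Cset h) :
    ∃ φstar : ℝ, Tendsto (fun k => envelope f g h γ (blockIterate xinit z I k)) atTop
      (𝓝 (φstar : EReal)) ∧ (⨅ x ∈ Cset h, cost f g x) ≤ (φstar : EReal) ∧
      (φstar : EReal) ≤ cost f g xinit := by
  have hanti := hr.antitone_envelope hb hN hxinit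
  have hlim := tendsto_atTop_iInf hanti
  set a := ⨅ k, envelope f g h γ (blockIterate xinit z I k) with ha
  have hlow : (⨅ x ∈ Cset h, cost f g x) ≤ a := le_iInf fun k =>
    (iInf₂_le (z k) (hr.z_mem_Cset hb k)).trans (hr.cost_z_le_envelope hb hN hxinit k)
  -- The minimizer over the closure of `C` keeps the limit away from `⊥`.
  have hbot : a ≠ ⊥ := by
    obtain ⟨x, hx, -, hmin⟩ := hb.solution
    have h1 : cost f g x ≤ a := (le_iInf₂ fun y hy => hmin y (subset_closure hy)).trans hlow
    exact ne_bot_of_le_ne_bot (hb.cost_ne_bot hN x) h1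
  have htop : a ≠ ⊤ := by
    refine ne_top_of_le_ne_top ?_ (iInf_le _ 0)
    rw [hr.envelope_eq hb hN hxinit]
    exact EReal.coe_ne_top _
  refine ⟨a.toReal, ?_⟩
  rw [EReal.coe_toReal htop hbot]
  exact ⟨hlim, hlow, (iInf_le _ 0).trans (hr.envelope_zero_le hb hN hxinit)⟩

end IsLowMemoryRun

/-! ### Limit points -/

section Limit

variable {f : Fin N → E n → EReal} {g : E n → EReal} {h : Fin N → E n → EReal} {L γ : Fin N → ℝ}
  {xinit : E n} {s z zt : ℕ → E n} {I K : ℕ → Finset (Fin N)} {φstar : ℝ} {τ : ℕ → ℕ}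

/-- At a full step the cost is squeezed between two consecutive values of the envelope. -/
theorem IsLowMemoryRun.tendsto_cost (hr : IsLowMemoryRun f g h γ xinit s z zt I K)
    (hb : BasicAssumption f g h L γ) (hN : 0 < N) (hxinit : xinit ∈ Cset h)
    (hlim : Tendsto (fun k => envelope f g h γ (blockIterate xinit z I k)) atTop
      (𝓝 (φstar : EReal))) (hτ : Tendsto τ atTop atTop) (hK : ∀ k, K (τ k) = ∅) :
    Tendsto (fun k => cost f g (z (τ k))) atTop (𝓝 (φstar : EReal)) := by
  refine tendsto_of_tendsto_of_tendsto_of_le_of_le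
    (hlim.comp ((tendsto_add_atTop_nat 1).comp hτ)) (hlim.comp hτ) (fun k => ?_) fun k =>
      hr.cost_z_le_envelope hb hN hxinit (τ k)
  have h1 := hr.envelope_succ_full_le hb hN hxinit (hK k)
    (Cset_subset_dom (hr.z_mem_Cset hb (τ k)))
  simpa using h1

/-- Passing to the limit in the definition of the envelope, with the distances of the kernels
`h_i/γ_i - f_i/N` replaced by the larger multiples of those of `h_i`. -/
theorem IsLowMemoryRun.le_cost_add (hr : IsLowMemoryRun f g h γ xinit s z zt I K)
    (hb : BasicAssumption f g h L γ) (hN : 0 < N) (hxinit : xinit ∈ Cset h)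
    (hlim : Tendsto (fun k => envelope f g h γ (blockIterate xinit z I k)) atTop
      (𝓝 (φstar : EReal))) (hτ : Tendsto τ atTop atTop) (hK : ∀ k, K (τ k) = ∅)
    (hconv : ∀ i, TwoSidedConvexOn (dom (h i)) (L i) (f i) (h i))
    {w : E n} (hw : ∀ i, w ∈ dom (h i)) {d : Fin N → ℝ}
    (hd : ∀ i, Tendsto (fun k => realBregman (h i) w (z (τ k))) atTop (𝓝 (d i))) :
    (φstar : EReal) ≤ cost f g w + ((∑ i, (1 / γ i + L i / N) * d i : ℝ) : EReal) := by
  by_cases hg : g w = ⊤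
  · rw [hb.cost_eq_top hN hg, EReal.top_add_coe]
    exact le_top
  · have h1 : Tendsto (fun k => ((costReal f g w +
        ∑ i, (1 / γ i + L i / N) * realBregman (h i) w (z (τ k)) : ℝ) : EReal)) atTop
        (𝓝 ((costReal f g w + ∑ i, (1 / γ i + L i / N) * d i : ℝ) : EReal)) :=
      EReal.tendsto_coe.mpr (tendsto_const_nhds.add
        (tendsto_finsetSum _ fun i _ => (hd i).const_mul _))
    rw [hb.cost_eq_coe hw hg, ← EReal.coe_add]
    refine le_of_tendsto_of_tendsto' (hlim.comp ((tendsto_add_atTop_nat 1).comp hτ)) h1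
      fun k => (hr.envelope_succ_full_le hb hN hxinit (hK k) hw).trans ?_
    rw [hb.cost_eq_coe hw hg, ← EReal.coe_add, EReal.coe_le_coe_iff]
    refine add_le_add_right (Finset.sum_le_sum fun i _ => hatDist_le ?_) _
    have hz := mem_iInter.mp (hr.z_mem_Cset hb (τ k)) i
    exact hb.abs_realBregman_le (hconv i) (hw i) (interior_subset hz) hz

/-- The cost is lower semicontinuous, so it cannot exceed the limit of its values. -/
theorem BasicAssumption.cost_le_of_tendsto (hb : BasicAssumption f g h L γ) (hN : 0 < N)
    {u : ℕ → E n} {x : E n} (hu : Tendsto u atTop (𝓝 x))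
    (hcost : Tendsto (fun k => cost f g (u k)) atTop (𝓝 (φstar : EReal))) :
    cost f g x ≤ φstar := by
  refine le_of_forall_lt fun c hc => ?_
  obtain ⟨c', hcc', hc'⟩ := exists_between hc
  exact hcc'.trans_le (ge_of_tendsto hcost
    ((hu.eventually (hb.lowerSemicontinuous_cost hN x c' hc')).mono fun k hk => hk.le))

/-- At interior points this is continuity, at boundary points it is what `BoundaryRegular` asks. -/
theorem IsLegendreKernel.tendsto_realBregman_self {h : E n → EReal} (hh : IsLegendreKernel h)
    (hreg : BoundaryRegular h) {u : ℕ → E n} {x : E n} (hu : ∀ k, u k ∈ interior (dom h))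
    (hux : Tendsto u atTop (𝓝 x)) :
    x ∈ dom h ∧ Tendsto (fun k => realBregman h x (u k)) atTop (𝓝 0) := by
  have hx : x ∈ dom h :=
    hreg.1.mem_of_tendsto hux (Eventually.of_forall fun k => interior_subset (hu k))
  refine ⟨hx, ?_⟩
  by_cases hxi : x ∈ interior (dom h)
  · simpa [Function.comp_def] using (hh.continuousAt_realBregman x hxi).tendsto.comp hux
  · have h1 := hreg.2 u x hu ⟨subset_closure hx, hxi⟩ hux
    simp only [bregman_eq_coe hh.proper.1 (show x ∈ dom h from hx).ne (hu _)] at h1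
    exact EReal.tendsto_coe.mp h1

/-- A function that drops below its value at `x` only by `o(‖y - x‖)` has the regular subgradient
zero at `x`. -/
theorem zero_mem_regSubdiff {F : E n → EReal} {x : E n} {c : ℝ} (hx : F x = c) {r : E n → ℝ}
    (hr : r =o[𝓝 x] fun y => y - x) (hF : ∀ y, (c : EReal) ≤ F y + r y) :
    (0 : E n) ∈ regSubdiff F x := by
  refine ⟨by simp [hx], by simp [hx], le_of_forall_lt fun a ha => ?_⟩
  obtain ⟨b, hab, hb0⟩ := exists_between ha
  -- The bound holds eventually, so the punctured neighbourhood may be trivial (dimension zero).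
  have hlim : Tendsto (fun y => ((-(r y / ‖y - x‖) : ℝ) : EReal)) (𝓝[≠] x) (𝓝 0) := by
    have h1 : Tendsto (fun y => -(r y / ‖y - x‖)) (𝓝 x) (𝓝 (-0)) :=
      (hr.norm_right.tendsto_div_nhds_zero).neg
    rw [neg_zero] at h1
    exact EReal.tendsto_coe.mpr (h1.mono_left nhdsWithin_le_nhds)
  refine hab.trans_le (le_liminf_of_le (by isBoundedDefault) ?_)
  filter_upwards [hlim.eventually_const_lt hb0, self_mem_nhdsWithin] with y hy hyx
  have hpos : 0 < ‖y - x‖ := norm_pos_iff.mpr (sub_ne_zero.mpr hyx)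
  refine hy.le.trans ?_
  have h2 := hF y
  rw [hx, inner_zero_left, EReal.coe_zero, sub_zero, ← neg_div, EReal.coe_div]
  refine EReal.div_le_div_right_of_nonneg (EReal.coe_nonneg.mpr hpos.le) ?_
  generalize F y = v at h2 ⊢
  induction v using EReal.rec with
  | bot => simp at h2
  | coe t =>
    rw [← EReal.coe_add, EReal.coe_le_coe_iff] at h2
    rw [← EReal.coe_sub, EReal.coe_le_coe_iff]
    linarith
  | top => simp

end Limit

end BFinito

theorem mainTheorem7 {n N : ℕ} (hN : 0 < N)
    (f : Fin N → E n → EReal) (g : E n → EReal) (h : Fin N → E n → EReal) (L γ : Fin N → ℝ)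
    (hbasic : BasicAssumption f g h L γ)
    (xinit : E n) (hxinit : xinit ∈ Cset h)
    (s z zt : ℕ → E n) (I K : ℕ → Finset (Fin N))
    (hrun : IsLowMemoryRun f g h γ xinit s z zt I K) :
    ∃ φstar : ℝ,
      -- `φstar` is the limit of the decreasing values of the Bregman-Moreau envelope
      (Antitone fun k => envelope f g h γ (blockIterate xinit z I k)) ∧
      Tendsto (fun k => envelope f g h γ (blockIterate xinit z I k)) atTop (𝓝 (φstar : EReal)) ∧
      (⨅ x ∈ closure (Cset h), cost f g x) ≤ (⨅ x ∈ Cset h, cost f g x) ∧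
      (⨅ x ∈ Cset h, cost f g x) ≤ (φstar : EReal) ∧
      (φstar : EReal) ≤ cost f g xinit ∧
      -- convergence of the cost
      Tendsto (fun k => cost f g (zt k)) atTop (𝓝 (φstar : EReal)) ∧
      -- constancy of the cost on the limit set
      ((∀ i, BoundaryRegular (h i)) → (∀ i, TwoSidedConvexOn (dom (h i)) (L i) (f i) (h i)) →
        ∀ zstar ∈ limitSet zt, cost f g zstar = (φstar : EReal)) ∧
      -- stationarity of the limit points
      (Cset h = univ → ∀ zstar ∈ limitSet zt, (0 : E n) ∈ regSubdiff (cost f g) zstar) := by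
  obtain ⟨φstar, hlim, hlow, hup⟩ := hrun.envelope_bounds hbasic hN hxinit
  choose τ hτK hτz hτcard using hrun.exists_full_step
  have hτ : Tendsto τ atTop atTop :=
    tendsto_atTop_mono (fun k => show k - N ≤ τ k by have := hτcard k; omega)
      (tendsto_sub_atTop_nat N)
  have hzt : zt = fun k => z (τ k) := funext hτz
  have hcost : Tendsto (fun k => cost f g (zt k)) atTop (𝓝 (φstar : EReal)) := by
    rw [hzt]
    exact hrun.tendsto_cost hbasic hN hxinit hlim hτ hτK
  have hle : ∀ zstar ∈ limitSet zt, cost f g zstar ≤ φstar := by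
    rintro zstar ⟨κ, hκ, hu⟩
    exact hbasic.cost_le_of_tendsto hN hu (hcost.comp hκ.tendsto_atTop)
  refine ⟨φstar, hrun.antitone_envelope hbasic hN hxinit, hlim,
    biInf_mono fun x hx => subset_closure hx, hlow, hup, hcost, fun hreg hconv zstar hzs => ?_,
    fun hC zstar hzs => ?_⟩
  · refine le_antisymm (hle zstar hzs) ?_
    obtain ⟨κ, hκ, hu⟩ := hzs
    simp only [hzt] at hu
    have hself := fun i => (hbasic.legendre i).tendsto_realBregman_self (hreg i)
      (fun j => mem_iInter.mp (hrun.z_mem_Cset hbasic (τ (κ j))) i) hu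
    have h1 := hrun.le_cost_add hbasic hN hxinit hlim (hτ.comp hκ.tendsto_atTop)
      (fun j => hτK (κ j)) hconv (fun i => (hself i).1) (d := fun _ => 0) fun i => (hself i).2
    simpa using h1
  · have hint : ∀ i, interior (dom (h i)) = univ := fun i =>
      eq_univ_of_univ_subset (hC ▸ iInter_subset _ i)
    have hdom : ∀ i, dom (h i) = univ := fun i =>
      eq_univ_of_univ_subset (hint i ▸ interior_subset)
    have hconv : ∀ i, TwoSidedConvexOn (dom (h i)) (L i) (f i) (h i) := fun i => by
      have h1 := (hbasic.relSmooth i).convex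
      rwa [hint i, ← hdom i] at h1
    have hmem : ∀ x i, x ∈ interior (dom (h i)) := fun x i => hint i ▸ mem_univ x
    obtain ⟨κ, hκ, hu⟩ := id hzs
    simp only [hzt] at hu
    have hmin : ∀ w, (φstar : EReal) ≤ cost f g w +
        ((∑ i, (1 / γ i + L i / N) * realBregman (h i) w zstar : ℝ) : EReal) := fun w =>
      hrun.le_cost_add hbasic hN hxinit hlim (hτ.comp hκ.tendsto_atTop)
        (fun j => hτK (κ j)) hconv (fun i => interior_subset (hmem w i)) fun i =>
          ((hbasic.legendre i).continuousAt_realBregman w (hmem zstar i)).tendsto.comp hu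
    refine zero_mem_regSubdiff (le_antisymm (hle zstar hzs) ?_)
      (Asymptotics.IsLittleO.fun_sum fun i _ =>
        ((hbasic.legendre i).isLittleO_realBregman (hmem zstar i)).const_mul_left _) hmin
    simpa using hmin zstar
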